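/- Let $\omega=e^{i\pi/4}=(1+i)/\sqrt2$ and $$H=\tfrac1{\sqrt2}\begin{pmatrix}1&1\\1&-1\end{pmatrix},\quad S=\begin{pmatrix}1&0\\0&i\end{pmatrix},\quad T=\begin{pmatrix}1&0\\0&\omega\end{pmatrix},\quad X=\begin{pmatrix}0&1\\1&0\end{pmatrix},$$ and let $\mathcal S\subseteq U(2)$ be the (64-element) subgroup generated by $S$, $X$ and the scalar $\omega$. Let $\mathbb Z[\omega]=\{a\omega^3+b\omega^2+c\omega+d : a,b,c,d\in\mathbb Z\}$, let $\mathbb Z_2[\omega]=\mathbb Z[\omega]/(2)$ be the ring of residues, with quotient map $\rho:\mathbb Z[\omega]\to\mathbb Z_2[\omega]$, and write $pqrs$ (binary digits) for the residue $p\omega^3+q\omega^2+r\omega+s$. A natural number $k\ge 0$ is a denominator exponent of a $2\times2$ complex matrix $U$ if all entries of $\sqrt2^{\,k}U$ lie in $\mathbb Z[\omega]$; its $k$-residue is then the matrix $\rho_k(U)=\rho(\sqrt2^{\,k}U)$, with $\rho$ applied entrywise. For $2\times 2$ residue matrices write $P\sim_{\mathcal S}Q$ if $Q=P\cdot\rho(A)$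 for some $A\in\mathcal S$. Let $M$ be a normal form of the shape $$(T\mid\varepsilon)\,(HT\mid SHT)^*\,(\varepsilon\mid H\mid SH)\,\mathcal S,$$ that is, a word in $H,S,T$ matching the regular expression $(T\mid\varepsilon)(HT\mid SHT)^*(\varepsilon\mid H\mid SH)$, followed by one element of $\mathcal S$. Let $U\in U(2)$ be the operator of $M$ (the product of its symbols as matrices, in the order written), and let $t$ and $h$ be the numbers of symbols $T$ and $H$ in the word. Then $U$ has a denominator exponent, and, with $k$ its least one and $R=\rho_k(U)$, there is exactly one matrix $V$ among the 26 matrices listed below such that $R\sim_{\mathcal S}V$; moreover $h$, $t$ and $k$ satisfy the relation with which that $V$ is listed. - $h=t=2k=0$: $\begin{pmatrix}0001&0000\\0000&0001\end{pmatrix}$ - $h=t-1=2k=0$: $\begin{pmatrix}0001&0000\\0000&0010\end{pmatrix}$ - $h+1=t+2=2k=2$: $\begin{pmatrix}0001&0001\\0001&0001\end{pmatrix},\ \begin{pmatrix}0001&0001\\0100&0100\end{pmatrix}$ - $h+1=t+1=2k=2$: $\begin{pmatrix}0001&0010\\0001&0010\end{pmatrix},\ \begin{pmatrix}0001&0010\\0100&1000\end{pmatrix},\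 \begin{pmatrix}0001&0001\\0010&0010\end{pmatrix},\ \begin{pmatrix}0001&0001\\1000&1000\end{pmatrix}$ - $h+1=t=2k=2$: $\begin{pmatrix}0001&0010\\0010&0100\end{pmatrix},\ \begin{pmatrix}0001&0010\\1000&0001\end{pmatrix}$ - $h+2=t+3=2k\ge 4$: $\begin{pmatrix}0011&0011\\0011&0011\end{pmatrix},\ \begin{pmatrix}0011&0011\\1100&1100\end{pmatrix}$ - $h+2=t+2=2k\ge 4$: $\begin{pmatrix}0011&0110\\0011&0110\end{pmatrix},\ \begin{pmatrix}0011&0110\\1100&1001\end{pmatrix},\ \begin{pmatrix}0011&0011\\0110&0110\end{pmatrix},\ \begin{pmatrix}0011&0011\\1001&1001\end{pmatrix}$ - $h+2=t+1=2k\ge 4$: $\begin{pmatrix}0011&0110\\0110&1100\end{pmatrix},\ \begin{pmatrix}0011&0110\\1001&0011\end{pmatrix}$ - $h+1=t+2=2k\ge 4$: $\begin{pmatrix}1000&0111\\0111&1000\end{pmatrix},\ \begin{pmatrix}1000&0111\\1101&0010\end{pmatrix}$ - $h+1=t+1=2k\ge 4$: $\begin{pmatrix}1000&1110\\0111&0001\end{pmatrix},\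 \begin{pmatrix}1000&1110\\1101&0100\end{pmatrix},\ \begin{pmatrix}1000&0111\\1110&0001\end{pmatrix},\ \begin{pmatrix}1000&0111\\1011&0100\end{pmatrix}$ - $h+1=t=2k\ge 4$: $\begin{pmatrix}1000&1110\\1110&0010\end{pmatrix},\ \begin{pmatrix}1000&1110\\1011&1000\end{pmatrix}$ -/

import Mathlib

namespace MatsumotoAmano

open Complex

/-- The group `U(2)`. -/
abbrev U2 := Matrix.unitaryGroup (Fin 2) ℂ

/-- `√2` as a complex number. -/
noncomputable def rt2 : ℂ := (Real.sqrt 2 : ℝ)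

theorem rt2_sq : rt2 * rt2 = 2 := by
  unfold rt2
  rw [← ofReal_mul, Real.mul_self_sqrt (by norm_num)]
  norm_num

theorem rt2_ne : rt2 ≠ 0 := fun h => by simpa [h] using rt2_sq

theorem star_rt2 : star rt2 = rt2 := by
  simp [rt2]

/-- `ω = (1 + i) / √2 = e^{iπ/4}`. -/
noncomputable def ω : ℂ := (1 + I) / rt2

theorem ω_sq : ω ^ 2 = I := by
  have h := rt2_sq
  have h0 := rt2_ne
  unfold ω
  rw [div_pow, div_eq_iff (pow_ne_zero 2 h0), pow_two rt2, h]
  linear_combination I_sq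

theorem ω_four : ω ^ 4 = -1 := by
  rw [show ω ^ 4 = (ω ^ 2) ^ 2 by ring, ω_sq, I_sq]

theorem star_ω_mul : star ω * ω = 1 := by
  have h := rt2_sq
  have h0 := rt2_ne
  have hs : star ω = (1 - I) / rt2 := by
    unfold ω
    rw [star_div₀, star_rt2]
    simp [sub_eq_add_neg]
  rw [hs, ω, div_mul_div_comm, h]
  linear_combination (-1 / 2 : ℂ) * I_sq

theorem star_ω : star ω = -ω ^ 3 := by
  linear_combination (-ω ^ 3) * star_ω_mul + (star ω) * ω_four

/-- The ring `ℤ[ω] = {aω³ + bω² + cω + d ∣ a, b, c, d ∈ ℤ}` of cyclotomic integers of degree 8. -/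
noncomputable def Zω : Subring ℂ where
  carrier := {z | ∃ a b c d : ℤ, z = a * ω ^ 3 + b * ω ^ 2 + c * ω + d}
  zero_mem' := ⟨0, 0, 0, 0, by simp⟩
  one_mem' := ⟨0, 0, 0, 1, by simp⟩
  add_mem' := by
    rintro _ _ ⟨a, b, c, d, rfl⟩ ⟨a', b', c', d', rfl⟩
    exact ⟨a + a', b + b', c + c', d + d', by push_cast; ring⟩
  neg_mem' := by
    rintro _ ⟨a, b, c, d, rfl⟩
    exact ⟨-a, -b, -c, -d, by push_cast; ring⟩
  mul_mem' := by
    rintro _ _ ⟨a, b, c, d, rfl⟩ ⟨a', b', c', d', rfl⟩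
    refine ⟨a * d' + b * c' + c * b' + d * a', b * d' + c * c' + d * b' - a * a',
      c * d' + d * c' - a * b' - b * a', d * d' - a * c' - b * b' - c * a', ?_⟩
    push_cast
    linear_combination ((a * a' : ℂ) * ω ^ 2 + (a * b' + b * a') * ω
      + (a * c' + b * b' + c * a')) * ω_four

theorem ω_mem : ω ∈ Zω := ⟨0, 0, 1, 0, by simp⟩

theorem I_mem : I ∈ Zω := ω_sq ▸ pow_mem ω_mem 2

theorem star_mem_Zω {z : ℂ} (hz : z ∈ Zω) : star z ∈ Zω := by
  obtain ⟨a, b, c, d, rfl⟩ := hz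
  have h : star ((a : ℂ) * ω ^ 3 + b * ω ^ 2 + c * ω + d)
      = a * (-ω ^ 3) ^ 3 + b * (-ω ^ 3) ^ 2 + c * (-ω ^ 3) + d := by
    rw [← star_ω]
    simp
  rw [h]
  have hω := neg_mem (pow_mem ω_mem 3)
  exact add_mem (add_mem (add_mem (mul_mem (intCast_mem _ a) (pow_mem hω 3))
    (mul_mem (intCast_mem _ b) (pow_mem hω 2))) (mul_mem (intCast_mem _ c) hω)) (intCast_mem _ d)

/-- The 16-element ring of residues `ℤ₂[ω] = ℤ[ω] / (2)`. -/
abbrev Residue := Zω ⧸ Ideal.span ({2} : Set Zω)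

/-- The residue map `ρ : ℤ[ω] → ℤ₂[ω]`. -/
noncomputable def ρ : Zω →+* Residue := Ideal.Quotient.mk _

/-- The residue `pω³ + qω² + rω + s`, abbreviated `pqrs` for binary digits `p, q, r, s`. -/
noncomputable def bits (p q r s : ℤ) : Residue :=
  let w : Zω := ⟨ω, ω_mem⟩
  ρ (p * w ^ 3 + q * w ^ 2 + r * w + s)

/-- `k` is a denominator exponent of the matrix `U`: all entries of `√2ᵏ U` are in `ℤ[ω]`. -/
def IsDenomExp (U : Matrix (Fin 2) (Fin 2) ℂ) (k : ℕ) : Prop :=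
  ∀ i j, rt2 ^ k * U i j ∈ Zω

/-- The `k`-residue `ρₖ(U) = ρ(√2ᵏ U)`, where `k` is a denominator exponent of `U`. -/
noncomputable def kResidue (U : Matrix (Fin 2) (Fin 2) ℂ) (k : ℕ) (hk : IsDenomExp U k) :
    Matrix (Fin 2) (Fin 2) Residue :=
  Matrix.of fun i j => ρ ⟨rt2 ^ k * U i j, hk i j⟩

/-- The Hadamard gate. -/
noncomputable def gateH : U2 :=
  ⟨(1 / rt2) • !![1, 1; 1, -1], by
    have h : rt2⁻¹ * rt2⁻¹ = 1 / 2 := by rw [← mul_inv, rt2_sq, one_div]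
    rw [Matrix.mem_unitaryGroup_iff]
    ext i j
    fin_cases i <;> fin_cases j <;>
      simp [Matrix.mul_apply, Fin.sum_univ_two, ← starRingEnd_apply, h,
        show (starRingEnd ℂ) rt2 = rt2 from star_rt2]
    all_goals norm_num⟩

/-- The phase gate. -/
noncomputable def gateS : U2 :=
  ⟨!![1, 0; 0, I], by
    rw [Matrix.mem_unitaryGroup_iff]
    ext i j
    fin_cases i <;> fin_cases j <;> simp [Matrix.mul_apply, Fin.sum_univ_two]⟩

/-- The `T`-gate. -/
noncomputable def gateT : U2 :=
  ⟨!![1, 0; 0, ω], by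
    have h : ω * star ω = 1 := by rw [mul_comm, star_ω_mul]
    rw [Matrix.mem_unitaryGroup_iff]
    ext i j
    fin_cases i <;> fin_cases j <;>
      simp [Matrix.mul_apply, Fin.sum_univ_two] <;> simpa using h⟩

/-- The Pauli operator `X`. -/
noncomputable def gateX : U2 :=
  ⟨!![0, 1; 1, 0], by
    rw [Matrix.mem_unitaryGroup_iff]
    ext i j
    fin_cases i <;> fin_cases j <;> simp [Matrix.mul_apply, Fin.sum_univ_two]⟩

/-- The scalar `ω`, as an operator. -/
noncomputable def gateω : U2 :=
  ⟨!![ω, 0; 0, ω], by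
    have h : ω * star ω = 1 := by rw [mul_comm, star_ω_mul]
    rw [Matrix.mem_unitaryGroup_iff]
    ext i j
    fin_cases i <;> fin_cases j <;>
      simp [Matrix.mul_apply, Fin.sum_univ_two] <;> simpa using h⟩

/-- The 64-element subgroup of the Clifford group generated by `S`, `X` and `ω`. -/
noncomputable def 𝒮 : Subgroup U2 := Subgroup.closure {gateS, gateX, gateω}

theorem isDenomExp_zero_of_mem {A : U2} (hA : A ∈ 𝒮) : IsDenomExp A.1 0 := by
  suffices h : ∀ i j, A.1 i j ∈ Zω from fun i j => by simpa using h i j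
  induction hA using Subgroup.closure_induction with
  | mem x hx =>
    intro i j
    rcases hx with rfl | rfl | rfl <;> fin_cases i <;> fin_cases j <;>
      simp [gateS, gateX, gateω, ω_mem, I_mem]
  | one =>
    intro i j
    fin_cases i <;> fin_cases j <;> simp
  | mul x y _ _ hx hy =>
    intro i j
    rw [show (x * y).1 = x.1 * y.1 from rfl, Matrix.mul_apply]
    exact sum_mem fun l _ => mul_mem (hx i l) (hy l j)
  | inv x _ hx =>
    intro i j
    rw [show (x⁻¹).1 i j = star (x.1 j i) from rfl]
    exact star_mem_Zω (hx j i)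

/-- The residue matrix `ρ(A)` of `A ∈ 𝒮`. -/
noncomputable def residueOf (A : 𝒮) : Matrix (Fin 2) (Fin 2) Residue :=
  kResidue A.1.1 0 (isDenomExp_zero_of_mem A.2)

/-- `P ∼ Q` if `P • A = Q` for some `A ∈ 𝒮`, where `P • A = P · ρ(A)` is the right action of `𝒮` on
residue matrices. -/
def SEquiv (P Q : Matrix (Fin 2) (Fin 2) Residue) : Prop :=
  ∃ A : 𝒮, P * residueOf A = Q

/-- The symbols `H`, `S`, `T` of which a normal form, except for its last symbol, consists. -/
inductive Gate
  | H | S | T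
  deriving DecidableEq

/-- The operator that a symbol denotes. -/
noncomputable def Gate.op : Gate → U2
  | .H => gateH
  | .S => gateS
  | .T => gateT

open RegularExpression in
/-- The regular expression `(T ∣ ε)(HT ∣ SHT)*(ε ∣ H ∣ SH)`. -/
def normalFormExpr : RegularExpression Gate :=
  (char Gate.T + 1) *
    RegularExpression.star (char Gate.H * char Gate.T + char Gate.S * char Gate.H * char Gate.T) *
    (1 + char Gate.H + char Gate.S * char Gate.H)

/-- A normal form `(T ∣ ε)(HT ∣ SHT)*(ε ∣ H ∣ SH) 𝒮`: a word that matches the regular expression,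
followed by an element of `𝒮` as its rightmost symbol. -/
structure NormalForm where
  word : List Gate
  word_mem : word ∈ normalFormExpr.matches'
  last : 𝒮

/-- The operator of a normal form, with composition written as matrix multiplication. -/
noncomputable def NormalForm.op (M : NormalForm) : U2 :=
  (M.word.map Gate.op).prod * M.last

/-- The `T`-count. -/
def NormalForm.tCount (M : NormalForm) : ℕ := M.word.count .T

/-- The `H`-count. -/
def NormalForm.hCount (M : NormalForm) : ℕ := M.word.count .H

/-- The vertices of the transition figure, named by the row and the column in which they are drawn.
Vertices that are only duplicates of another vertex, or that carry a reducible matrix, are not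
listed. -/
inductive Vertex
  | r1c1 | r1c3
  | r2c1 | r2c2 | r2c3 | r2c4
  | r3c1 | r3c2 | r3c3 | r3c4
  | r4c1 | r4c2 | r4c3 | r4c4
  | r5c1 | r5c2 | r5c3 | r5c4
  | r7c1 | r7c2 | r7c3 | r7c4
  | r8c1 | r8c2 | r8c3 | r8c4

/-- The residue matrix at a vertex (a representative modulo the right action of `𝒮`). -/
noncomputable def Vertex.matrix : Vertex → Matrix (Fin 2) (Fin 2) Residue
  | .r1c1 => !![bits 0 0 0 1, bits 0 0 0 0; bits 0 0 0 0, bits 0 0 0 1]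
  | .r1c3 => !![bits 0 0 0 1, bits 0 0 0 0; bits 0 0 0 0, bits 0 0 1 0]
  | .r2c1 => !![bits 0 0 0 1, bits 0 0 0 1; bits 0 0 0 1, bits 0 0 0 1]
  | .r2c2 => !![bits 0 0 0 1, bits 0 0 0 1; bits 0 1 0 0, bits 0 1 0 0]
  | .r2c3 => !![bits 0 0 0 1, bits 0 0 1 0; bits 0 0 0 1, bits 0 0 1 0]
  | .r2c4 => !![bits 0 0 0 1, bits 0 0 1 0; bits 0 1 0 0, bits 1 0 0 0]
  | .r3c1 => !![bits 0 0 0 1, bits 0 0 0 1; bits 0 0 1 0, bits 0 0 1 0]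
  | .r3c2 => !![bits 0 0 0 1, bits 0 0 0 1; bits 1 0 0 0, bits 1 0 0 0]
  | .r3c3 => !![bits 0 0 0 1, bits 0 0 1 0; bits 0 0 1 0, bits 0 1 0 0]
  | .r3c4 => !![bits 0 0 0 1, bits 0 0 1 0; bits 1 0 0 0, bits 0 0 0 1]
  | .r4c1 => !![bits 0 0 1 1, bits 0 0 1 1; bits 0 0 1 1, bits 0 0 1 1]
  | .r4c2 => !![bits 0 0 1 1, bits 0 0 1 1; bits 1 1 0 0, bits 1 1 0 0]
  | .r4c3 => !![bits 0 0 1 1, bits 0 1 1 0; bits 0 0 1 1, bits 0 1 1 0]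
  | .r4c4 => !![bits 0 0 1 1, bits 0 1 1 0; bits 1 1 0 0, bits 1 0 0 1]
  | .r5c1 => !![bits 0 0 1 1, bits 0 0 1 1; bits 0 1 1 0, bits 0 1 1 0]
  | .r5c2 => !![bits 0 0 1 1, bits 0 0 1 1; bits 1 0 0 1, bits 1 0 0 1]
  | .r5c3 => !![bits 0 0 1 1, bits 0 1 1 0; bits 0 1 1 0, bits 1 1 0 0]
  | .r5c4 => !![bits 0 0 1 1, bits 0 1 1 0; bits 1 0 0 1, bits 0 0 1 1]
  | .r7c1 => !![bits 1 0 0 0, bits 0 1 1 1; bits 0 1 1 1, bits 1 0 0 0]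
  | .r7c2 => !![bits 1 0 0 0, bits 0 1 1 1; bits 1 1 0 1, bits 0 0 1 0]
  | .r7c3 => !![bits 1 0 0 0, bits 1 1 1 0; bits 0 1 1 1, bits 0 0 0 1]
  | .r7c4 => !![bits 1 0 0 0, bits 1 1 1 0; bits 1 1 0 1, bits 0 1 0 0]
  | .r8c1 => !![bits 1 0 0 0, bits 0 1 1 1; bits 1 1 1 0, bits 0 0 0 1]
  | .r8c2 => !![bits 1 0 0 0, bits 0 1 1 1; bits 1 0 1 1, bits 0 1 0 0]
  | .r8c3 => !![bits 1 0 0 0, bits 1 1 1 0; bits 1 1 1 0, bits 0 0 1 0]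
  | .r8c4 => !![bits 1 0 0 0, bits 1 1 1 0; bits 1 0 1 1, bits 1 0 0 0]

/-- The relation between `H`-count `h`, `T`-count `t` and least denominator exponent `k` with which
a vertex is labelled. -/
def Vertex.label (h t k : ℤ) : Vertex → Prop
  | .r1c1 => h = t ∧ t = 2 * k ∧ 2 * k = 0
  | .r1c3 => h = t - 1 ∧ t - 1 = 2 * k ∧ 2 * k = 0
  | .r2c1 | .r2c2 => h + 1 = t + 2 ∧ t + 2 = 2 * k ∧ 2 * k = 2
  | .r2c3 | .r2c4 | .r3c1 | .r3c2 => h + 1 = t + 1 ∧ t + 1 = 2 * k ∧ 2 * k = 2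
  | .r3c3 | .r3c4 => h + 1 = t ∧ t = 2 * k ∧ 2 * k = 2
  | .r4c1 | .r4c2 => h + 2 = t + 3 ∧ t + 3 = 2 * k ∧ 2 * k ≥ 4
  | .r4c3 | .r4c4 | .r5c1 | .r5c2 => h + 2 = t + 2 ∧ t + 2 = 2 * k ∧ 2 * k ≥ 4
  | .r5c3 | .r5c4 => h + 2 = t + 1 ∧ t + 1 = 2 * k ∧ 2 * k ≥ 4
  | .r7c1 | .r7c2 => h + 1 = t + 2 ∧ t + 2 = 2 * k ∧ 2 * k ≥ 4
  | .r7c3 | .r7c4 | .r8c1 | .r8c2 => h + 1 = t + 1 ∧ t + 1 = 2 * k ∧ 2 * k ≥ 4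
  | .r8c3 | .r8c4 => h + 1 = t ∧ t = 2 * k ∧ 2 * k ≥ 4

end MatsumotoAmano

/-!
A normal form is built from its right end by left multiplications with `T`, `S` and `H`, which
commute with the right action of `𝒮`. So it is enough to follow the vertex of an operator through
these multiplications, starting from the identity. The residue ring `ℤ₂[ω]` has an explicit model
`Coord` of 16 elements, in which all statements about residue matrices are finite computations, and
by `cliffordResidues` the group `𝒮` acts on residue matrices through 16 elements.

Multiplication by `T` or `S` leaves the denominator exponent alone, and the new residue matrix is
determined by the old one. Multiplication by `H` turns a `k`-residue `R` into the `(k + 1)`-residue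
`√2 H · R`. At most vertices where the normal form calls for an `H` this matrix is still irreducible
(`resH_mul_coord`), so `k + 1` is the new least denominator exponent. At the vertices of the fifth
row it is divisible by `√2`, and so `k` remains a denominator exponent; but the `k`-residue `X` of
the product depends on more than `R`. Two facts pin it down up to `𝒮`
(`reduced_resH_mul_coord`): the relations `√2 X = √2 H · R` and `√2 R = √2 H · X`, the latter
because `H` is an involution; and unitarity, which forces the number of binary digits `1` in each
row of `X` to be divisible by `4` (`HasResidue.four_dvd_weight`).

The exponent reached is the least one, because the vertex matrices are not divisible by `√2`
(`sqrtTwo_smul_coord_ne_zero`), and the vertex is unique, because the vertex matrices are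
inequivalent under `𝒮` (`vertices_pairwise`).
-/

namespace MatsumotoAmano

open Complex

/-! ### Cyclotomic integers -/

theorem int_add_mul_sqrt_two_eq_zero {x y : ℤ} (h : (x : ℝ) + y * √2 = 0) : x = 0 ∧ y = 0 := by
  have hy : y = 0 := by
    by_contra hy
    refine (irrational_iff_ne_rational _).1 irrational_sqrt_two (-x) y hy ?_
    have : (y : ℝ) ≠ 0 := by exact_mod_cast hy
    rw [eq_div_iff this]
    push_cast
    linarith
  subst hy
  simpa using h

theorem ω_mul_rt2 : ω * rt2 = 1 + I := div_mul_cancel₀ _ rt2_ne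

theorem rt2_eq : rt2 = ω - ω ^ 3 := by
  refine mul_right_cancel₀ rt2_ne ?_
  linear_combination rt2_sq - ω_mul_rt2 + ω * rt2 * ω_sq + I * ω_mul_rt2 + I_sq

/-- `1, ω, ω², ω³` are linearly independent over `ℤ`. -/
theorem coords_eq_zero {a b c d : ℤ} (h : (a : ℂ) * ω ^ 3 + b * ω ^ 2 + c * ω + d = 0) :
    a = 0 ∧ b = 0 ∧ c = 0 ∧ d = 0 := by
  have h' : (a : ℂ) * (I - 1) + b * I * rt2 + c * (1 + I) + d * rt2 = 0 := by
    linear_combination rt2 * h - (a * ω * rt2 + b * rt2) * ω_sq - (a * I + c) * ω_mul_rt2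
      - a * I_sq
  have hre := congrArg re h'
  have him := congrArg im h'
  simp [rt2] at hre him
  obtain ⟨h1, h2⟩ := int_add_mul_sqrt_two_eq_zero (x := c - a) (y := d)
    (by push_cast; linarith)
  obtain ⟨h3, h4⟩ := int_add_mul_sqrt_two_eq_zero (x := c + a) (y := b)
    (by push_cast; linarith)
  omega

/-- The squared norm of a cyclotomic integer, split along the basis `1, √2` of the real subring. -/
theorem mul_star_eq (a b c d : ℤ) :
    ((a : ℂ) * ω ^ 3 + b * ω ^ 2 + c * ω + d) * star ((a : ℂ) * ω ^ 3 + b * ω ^ 2 + c * ω + d)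
      = ((a ^ 2 + b ^ 2 + c ^ 2 + d ^ 2 : ℤ) : ℂ)
        + ((a * b + b * c + c * d - d * a : ℤ) : ℂ) * rt2 := by
  have h : star ((a : ℂ) * ω ^ 3 + b * ω ^ 2 + c * ω + d)
      = -(a * ω) - b * ω ^ 2 - c * ω ^ 3 + d := by
    have h : star ((a : ℂ) * ω ^ 3 + b * ω ^ 2 + c * ω + d)
        = a * (-ω ^ 3) ^ 3 + b * (-ω ^ 3) ^ 2 + c * (-ω ^ 3) + d := by
      rw [← star_ω]
      simp
    rw [h]
    linear_combination (-(a * ω) * (ω ^ 4 - 1) + b * ω ^ 2) * ω_four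
  rw [h, rt2_eq]
  push_cast
  linear_combination (-(a * a + b * b + c * c : ℂ) - (a * b + b * c) * ω - a * c * ω ^ 2) * ω_four

/-! ### The residue ring in coordinates -/

/-- The residue ring `ℤ₂[ω]` in coordinates: `⟨p, q, r, s⟩` stands for `pω³ + qω² + rω + s`. Unlike
the quotient `Residue`, this ring can be computed with. -/
@[ext]
structure Coord where
  (p q r s : ZMod 2)
  deriving DecidableEq

namespace Coord

instance : Zero Coord := ⟨⟨0, 0, 0, 0⟩⟩
instance : One Coord := ⟨⟨0, 0, 0, 1⟩⟩
instance : Add Coord := ⟨fun x y => ⟨x.p + y.p, x.q + y.q, x.r + y.r, x.s + y.s⟩⟩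
instance : Neg Coord := ⟨fun x => x⟩
-- Here `ω⁴ = -1 = 1`, the ring having characteristic `2`.
instance : Mul Coord := ⟨fun x y =>
  ⟨x.p * y.s + x.q * y.r + x.r * y.q + x.s * y.p,
    x.q * y.s + x.r * y.r + x.s * y.q + x.p * y.p,
    x.r * y.s + x.s * y.r + x.p * y.q + x.q * y.p,
    x.s * y.s + x.p * y.r + x.q * y.q + x.r * y.p⟩⟩

theorem zero_def : (0 : Coord) = ⟨0, 0, 0, 0⟩ := rfl
theorem one_def : (1 : Coord) = ⟨0, 0, 0, 1⟩ := rfl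
theorem add_def (x y : Coord) : x + y = ⟨x.p + y.p, x.q + y.q, x.r + y.r, x.s + y.s⟩ := rfl
theorem neg_def (x : Coord) : -x = x := rfl
theorem mul_def (x y : Coord) : x * y =
    ⟨x.p * y.s + x.q * y.r + x.r * y.q + x.s * y.p,
      x.q * y.s + x.r * y.r + x.s * y.q + x.p * y.p,
      x.r * y.s + x.s * y.r + x.p * y.q + x.q * y.p,
      x.s * y.s + x.p * y.r + x.q * y.q + x.r * y.p⟩ := rfl

instance : CommRing Coord where
  add_assoc x y z := by simp only [add_def, add_assoc]
  zero_add x := by simp [add_def, zero_def]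
  add_zero x := by simp [add_def, zero_def]
  add_comm x y := by simp only [add_def, add_comm]
  neg_add_cancel x := by simp [add_def, neg_def, zero_def, CharTwo.add_self_eq_zero]
  left_distrib x y z := by simp only [add_def, mul_def]; ext <;> ring
  right_distrib x y z := by simp only [add_def, mul_def]; ext <;> ring
  zero_mul x := by simp [mul_def, zero_def]
  mul_zero x := by simp [mul_def, zero_def]
  mul_assoc x y z := by simp only [mul_def]; ext <;> ring
  one_mul x := by simp [mul_def, one_def]
  mul_one x := by simp [mul_def, one_def]
  mul_comm x y := by simp only [mul_def]; ext <;> ring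
  nsmul := nsmulRec
  zsmul := zsmulRec

end Coord

/-- An element of `ℤ[ω]` with residue `0` has even coordinates. -/
theorem two_dvd_coords {z : Zω} (hz : ρ z = 0) {a b c d : ℤ}
    (h : (z : ℂ) = a * ω ^ 3 + b * ω ^ 2 + c * ω + d) : 2 ∣ a ∧ 2 ∣ b ∧ 2 ∣ c ∧ 2 ∣ d := by
  obtain ⟨⟨_, a', b', c', d', rfl⟩, rfl⟩ :=
    Ideal.mem_span_singleton'.1 (Ideal.Quotient.eq_zero_iff_mem.1 hz)
  obtain ⟨ha, hb, hc, hd⟩ := coords_eq_zero (a := a - 2 * a') (b := b - 2 * b') (c := c - 2 * c')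
    (d := d - 2 * d') (by
      have h2 : ((2 : Zω) : ℂ) = 2 := rfl
      simp only [Subring.coe_mul, h2] at h
      push_cast
      linear_combination -h)
  omega

theorem residue_two : (2 : Residue) = 0 := by
  have h : ρ 2 = 0 := Ideal.Quotient.eq_zero_iff_mem.2 (Ideal.mem_span_singleton_self _)
  rwa [map_ofNat] at h

instance : Nontrivial Residue := by
  refine ⟨1, 0, fun h => ?_⟩
  have := two_dvd_coords (z := 1) (by rw [map_one, h]) (a := 0) (b := 0) (c := 0) (d := 1)
    (by simp)
  omega

instance : CharP Residue 2 := CharTwo.of_one_ne_zero_of_two_eq_zero one_ne_zero residue_two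

/-- The class of `ω` in `ℤ₂[ω]`. -/
noncomputable def ωbar : Residue := ρ ⟨ω, ω_mem⟩

theorem ωbar_four : ωbar ^ 4 = 1 := by
  have h : (⟨ω, ω_mem⟩ : Zω) ^ 4 = -1 := Subtype.ext (by simp [ω_four])
  rw [ωbar, ← map_pow, h, map_neg, map_one, CharTwo.neg_eq]

/-- The identification of the coordinate model with `ℤ₂[ω]`. -/
noncomputable def toResidue : Coord →+* Residue where
  toFun x :=
    let c := ZMod.castHom (dvd_refl 2) Residue
    c x.p * ωbar ^ 3 + c x.q * ωbar ^ 2 + c x.r * ωbar + c x.s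
  map_one' := by simp [Coord.one_def]
  map_zero' := by simp [Coord.zero_def]
  map_add' x y := by simp only [Coord.add_def, map_add]; ring
  map_mul' x y := by
    simp only [Coord.mul_def, map_add, map_mul]
    generalize ZMod.castHom (dvd_refl 2) Residue = c
    linear_combination (-(c x.p * c y.p * ωbar ^ 2) - (c x.p * c y.q + c x.q * c y.p) * ωbar
      - (c x.p * c y.r + c x.q * c y.q + c x.r * c y.p)) * ωbar_four

theorem ρ_coords {z : Zω} {a b c d : ℤ} (h : (z : ℂ) = a * ω ^ 3 + b * ω ^ 2 + c * ω + d) :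
    ρ z = toResidue ⟨a, b, c, d⟩ := by
  have : z = a * ⟨ω, ω_mem⟩ ^ 3 + b * ⟨ω, ω_mem⟩ ^ 2 + c * ⟨ω, ω_mem⟩ + d :=
    Subtype.ext (by simp [h])
  rw [this]
  simp [toResidue, ωbar, -SubmonoidClass.mk_pow]

theorem bits_eq (p q r s : ℤ) : bits p q r s = toResidue ⟨p, q, r, s⟩ :=
  ρ_coords (by simp)

theorem toResidue_injective : Function.Injective toResidue := by
  rw [injective_iff_map_eq_zero]
  rintro ⟨p, q, r, s⟩ h
  obtain ⟨a, rfl⟩ := ZMod.intCast_surjective p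
  obtain ⟨b, rfl⟩ := ZMod.intCast_surjective q
  obtain ⟨c, rfl⟩ := ZMod.intCast_surjective r
  obtain ⟨d, rfl⟩ := ZMod.intCast_surjective s
  rw [← bits_eq] at h
  obtain ⟨h1, h2, h3, h4⟩ := two_dvd_coords h (a := a) (b := b) (c := c) (d := d) (by simp)
  simp [Coord.zero_def, ZMod.intCast_zmod_eq_zero_iff_dvd, *]

theorem exists_ρ_eq (z : Zω) : ∃ x, ρ z = toResidue x := by
  obtain ⟨a, b, c, d, h⟩ := z.2
  exact ⟨_, ρ_coords h⟩

/-! ### Residues of matrices -/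

/-- A residue matrix in coordinates. -/
abbrev CoordMatrix := Matrix (Fin 2) (Fin 2) Coord

/-- `k` is a denominator exponent of `U`, and `ρₖ(U) = R`. -/
def HasResidue (U : Matrix (Fin 2) (Fin 2) ℂ) (k : ℕ) (R : CoordMatrix) : Prop :=
  ∃ hk : IsDenomExp U k, kResidue U k hk = R.map toResidue

theorem rt2_mem : rt2 ∈ Zω := rt2_eq ▸ sub_mem ω_mem (pow_mem ω_mem 3)

/-- The residue of `√2 = ω - ω³`. -/
def sqrtTwo : Coord := ⟨1, 0, 1, 0⟩

theorem ρ_rt2 : ρ ⟨rt2, rt2_mem⟩ = toResidue sqrtTwo := by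
  rw [ρ_coords (a := -1) (b := 0) (c := 1) (d := 0) (by simp [rt2_eq]; ring)]
  congr

variable {U V : Matrix (Fin 2) (Fin 2) ℂ} {m n k : ℕ} {P Q R : CoordMatrix}

theorem IsDenomExp.mul (hU : IsDenomExp U m) (hV : IsDenomExp V n) :
    IsDenomExp (U * V) (m + n) := fun i j => by
  rw [Matrix.mul_apply, Finset.mul_sum]
  refine sum_mem fun l _ => ?_
  rw [show rt2 ^ (m + n) * (U i l * V l j) = (rt2 ^ m * U i l) * (rt2 ^ n * V l j) by ring]
  exact mul_mem (hU i l) (hV l j)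

theorem kResidue_mul (hU : IsDenomExp U m) (hV : IsDenomExp V n) :
    kResidue (U * V) (m + n) (hU.mul hV) = kResidue U m hU * kResidue V n hV := by
  ext i j
  simp only [kResidue, Matrix.mul_apply, Matrix.of_apply, ← map_mul, ← map_sum]
  congr 1
  refine Subtype.ext ?_
  simp only [Fin.sum_univ_two, Subring.coe_add, Subring.coe_mul]
  ring

theorem IsDenomExp.mono (hU : IsDenomExp U m) (h : m ≤ n) : IsDenomExp U n := fun i j => by
  obtain ⟨d, rfl⟩ := Nat.exists_eq_add_of_le' h
  rw [pow_add, mul_assoc]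
  exact mul_mem (pow_mem rt2_mem d) (hU i j)

theorem IsDenomExp.exists_hasResidue (hU : IsDenomExp U k) : ∃ R, HasResidue U k R := by
  choose R hR using fun i j => exists_ρ_eq ⟨_, hU i j⟩
  exact ⟨Matrix.of R, hU, by ext i j; exact hR i j⟩

namespace HasResidue

theorem mul (hU : HasResidue U m P) (hV : HasResidue V n Q) :
    HasResidue (U * V) (m + n) (P * Q) := by
  obtain ⟨hU, hP⟩ := hU
  obtain ⟨hV, hQ⟩ := hV
  exact ⟨hU.mul hV, by rw [kResidue_mul hU hV, hP, hQ, Matrix.map_mul]⟩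

theorem unique (hP : HasResidue U k P) (hQ : HasResidue U k Q) : P = Q := by
  obtain ⟨_, hP⟩ := hP
  obtain ⟨_, hQ⟩ := hQ
  exact Matrix.map_injective toResidue_injective (hP.symm.trans hQ)

theorem succ (hU : HasResidue U k R) : HasResidue U (k + 1) (sqrtTwo • R) := by
  obtain ⟨hk, hR⟩ := hU
  refine ⟨hk.mono k.le_succ, ?_⟩
  ext i j
  have h := congrFun (congrFun hR i) j
  simp only [kResidue, Matrix.of_apply, Matrix.map_apply, Matrix.smul_apply, smul_eq_mul,
    map_mul] at h ⊢
  rw [← h, ← ρ_rt2, ← map_mul]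
  congr 1
  exact Subtype.ext (by simp only [Subring.coe_mul]; ring)

/-- A residue divisible by `√2` can be reduced: modulo `2` the entry `√2ᵏ⁺¹ Uᵢⱼ` is a multiple of
`√2`, and `√2` divides `2`. -/
theorem isDenomExp_of_smul (hU : HasResidue U (k + 1) (sqrtTwo • R)) : IsDenomExp U k := by
  obtain ⟨hk, hR⟩ := hU
  intro i j
  have h := congrFun (congrFun hR i) j
  obtain ⟨⟨p, q, r, s⟩, hx⟩ : ∃ x, x = R i j := ⟨_, rfl⟩
  obtain ⟨a, rfl⟩ := ZMod.intCast_surjective p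
  obtain ⟨b, rfl⟩ := ZMod.intCast_surjective q
  obtain ⟨c, rfl⟩ := ZMod.intCast_surjective r
  obtain ⟨d, rfl⟩ := ZMod.intCast_surjective s
  simp only [kResidue, Matrix.of_apply, Matrix.map_apply, Matrix.smul_apply, smul_eq_mul,
    map_mul, ← hx, ← bits_eq, ← ρ_rt2] at h
  rw [bits, ← map_mul] at h
  obtain ⟨z, hz⟩ := Ideal.mem_span_singleton'.1 (Ideal.Quotient.eq.1 h)
  have hz' := congrArg (Subtype.val : Zω → ℂ) hz
  have h2 : ((2 : Zω) : ℂ) = 2 := rfl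
  simp only [Subring.coe_mul, AddSubgroupClass.coe_sub, h2] at hz'
  generalize (_ : Zω) + _ = y at hz'
  have : rt2 ^ k * U i j = y + rt2 * z := by
    refine mul_left_cancel₀ rt2_ne ?_
    linear_combination -z * rt2_sq - hz'
  rw [this]
  exact add_mem y.2 (mul_mem rt2_mem z.2)

end HasResidue

/-- The number of binary digits `1` of a residue. -/
def Coord.weight (x : Coord) : ℕ := x.p.val + x.q.val + x.r.val + x.s.val

theorem sq_emod_four (a : ℤ) : a ^ 2 % 4 = ((a : ZMod 2).val : ℤ) := by
  rcases Int.even_or_odd a with h | h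
  · rw [(ZMod.intCast_zmod_eq_zero_iff_dvd a 2).2 h.two_dvd]
    obtain ⟨b, rfl⟩ := h
    ring_nf
    simp
  · have h1 : (a : ZMod 2) = 1 := by
      obtain ⟨b, rfl⟩ := h
      push_cast
      rw [show (2 : ZMod 2) = 0 from rfl]
      ring
    rw [h1, Int.sq_mod_four_eq_one_of_odd h]
    rfl

/-- The rows of `√2ᵏ U` have squared norm `2ᵏ`. The coefficient of `1` in the squared norm is a sum
of eight integer squares, each congruent modulo `4` to the parity of its base. -/
theorem HasResidue.four_dvd_weight {U : U2} (hU : HasResidue U.1 k R) (hk : 2 ≤ k) (i : Fin 2) :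
    4 ∣ (R i 0).weight + (R i 1).weight := by
  obtain ⟨hd, hR⟩ := hU
  have hrow : U.1 i 0 * star (U.1 i 0) + U.1 i 1 * star (U.1 i 1) = 1 := by
    have := congrFun (congrFun (Matrix.mem_unitaryGroup_iff.1 U.2) i) i
    simpa [Matrix.mul_apply, Fin.sum_univ_two] using this
  have hscale (j : Fin 2) : (rt2 ^ k * U.1 i j) * star (rt2 ^ k * U.1 i j)
      = 2 ^ k * (U.1 i j * star (U.1 i j)) := by
    rw [star_mul, star_pow, star_rt2, ← rt2_sq]
    ring
  have hnorm : (rt2 ^ k * U.1 i 0) * star (rt2 ^ k * U.1 i 0)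
      + (rt2 ^ k * U.1 i 1) * star (rt2 ^ k * U.1 i 1) = 2 ^ k := by
    rw [hscale, hscale, ← mul_add, hrow, mul_one]
  obtain ⟨a, b, c, d, h⟩ := hd i 0
  obtain ⟨a', b', c', d', h'⟩ := hd i 1
  have h0 : R i 0 = ⟨a, b, c, d⟩ :=
    toResidue_injective ((congrFun (congrFun hR i) 0).symm.trans (ρ_coords h))
  have h1 : R i 1 = ⟨a', b', c', d'⟩ :=
    toResidue_injective ((congrFun (congrFun hR i) 1).symm.trans (ρ_coords h'))
  rw [h, h', mul_star_eq, mul_star_eq] at hnorm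
  obtain ⟨hsum, -⟩ := int_add_mul_sqrt_two_eq_zero
    (x := a ^ 2 + b ^ 2 + c ^ 2 + d ^ 2 + (a' ^ 2 + b' ^ 2 + c' ^ 2 + d' ^ 2) - 2 ^ k)
    (y := a * b + b * c + c * d - d * a + (a' * b' + b' * c' + c' * d' - d' * a')) (by
      rw [← ofReal_inj]
      push_cast [rt2] at hnorm ⊢
      linear_combination hnorm)
  obtain ⟨e, rfl⟩ := Nat.exists_eq_add_of_le hk
  rw [pow_add] at hsum
  simp only [h0, h1, Coord.weight]
  have := sq_emod_four a
  have := sq_emod_four b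
  have := sq_emod_four c
  have := sq_emod_four d
  have := sq_emod_four a'
  have := sq_emod_four b'
  have := sq_emod_four c'
  have := sq_emod_four d'
  omega

/-! ### The group `𝒮` and the vertices -/

/-- The residue matrix of `√2 H`. -/
def resH : CoordMatrix := !![1, 1; 1, 1]

/-- The residue matrix of `S`. -/
def resS : CoordMatrix := !![1, 0; 0, ⟨0, 1, 0, 0⟩]

/-- The residue matrix of `T`. -/
def resT : CoordMatrix := !![1, 0; 0, ⟨0, 0, 1, 0⟩]

/-- The residue matrix of `X`. -/
def resX : CoordMatrix := !![0, 1; 1, 0]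

/-- The residue matrix of the scalar `ω`. -/
def resω : CoordMatrix := !![⟨0, 0, 1, 0⟩, 0; 0, ⟨0, 0, 1, 0⟩]

/-- The residue matrices of the elements `ωʲ Sᵐ Xᵉ` of `𝒮` with `j < 4` and `m, e < 2`. As
`ω⁴ = -1` has residue `1`, these are the residue matrices of all elements of `𝒮`. -/
def cliffordResidues : List CoordMatrix :=
  [0, 1, 2, 3].flatMap fun j => [0, 1].flatMap fun m => [0, 1].map fun e =>
    resω ^ j * resS ^ m * resX ^ e

theorem mul_mem_cliffordResidues :
    ∀ a ∈ cliffordResidues, ∀ b ∈ cliffordResidues, a * b ∈ cliffordResidues := by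
  decide +kernel

/-- `Vertex.matrix` in coordinates. -/
def Vertex.coord : Vertex → CoordMatrix
  | .r1c1 => !![⟨0, 0, 0, 1⟩, ⟨0, 0, 0, 0⟩; ⟨0, 0, 0, 0⟩, ⟨0, 0, 0, 1⟩]
  | .r1c3 => !![⟨0, 0, 0, 1⟩, ⟨0, 0, 0, 0⟩; ⟨0, 0, 0, 0⟩, ⟨0, 0, 1, 0⟩]
  | .r2c1 => !![⟨0, 0, 0, 1⟩, ⟨0, 0, 0, 1⟩; ⟨0, 0, 0, 1⟩, ⟨0, 0, 0, 1⟩]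
  | .r2c2 => !![⟨0, 0, 0, 1⟩, ⟨0, 0, 0, 1⟩; ⟨0, 1, 0, 0⟩, ⟨0, 1, 0, 0⟩]
  | .r2c3 => !![⟨0, 0, 0, 1⟩, ⟨0, 0, 1, 0⟩; ⟨0, 0, 0, 1⟩, ⟨0, 0, 1, 0⟩]
  | .r2c4 => !![⟨0, 0, 0, 1⟩, ⟨0, 0, 1, 0⟩; ⟨0, 1, 0, 0⟩, ⟨1, 0, 0, 0⟩]
  | .r3c1 => !![⟨0, 0, 0, 1⟩, ⟨0, 0, 0, 1⟩; ⟨0, 0, 1, 0⟩, ⟨0, 0, 1, 0⟩]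
  | .r3c2 => !![⟨0, 0, 0, 1⟩, ⟨0, 0, 0, 1⟩; ⟨1, 0, 0, 0⟩, ⟨1, 0, 0, 0⟩]
  | .r3c3 => !![⟨0, 0, 0, 1⟩, ⟨0, 0, 1, 0⟩; ⟨0, 0, 1, 0⟩, ⟨0, 1, 0, 0⟩]
  | .r3c4 => !![⟨0, 0, 0, 1⟩, ⟨0, 0, 1, 0⟩; ⟨1, 0, 0, 0⟩, ⟨0, 0, 0, 1⟩]
  | .r4c1 => !![⟨0, 0, 1, 1⟩, ⟨0, 0, 1, 1⟩; ⟨0, 0, 1, 1⟩, ⟨0, 0, 1, 1⟩]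
  | .r4c2 => !![⟨0, 0, 1, 1⟩, ⟨0, 0, 1, 1⟩; ⟨1, 1, 0, 0⟩, ⟨1, 1, 0, 0⟩]
  | .r4c3 => !![⟨0, 0, 1, 1⟩, ⟨0, 1, 1, 0⟩; ⟨0, 0, 1, 1⟩, ⟨0, 1, 1, 0⟩]
  | .r4c4 => !![⟨0, 0, 1, 1⟩, ⟨0, 1, 1, 0⟩; ⟨1, 1, 0, 0⟩, ⟨1, 0, 0, 1⟩]
  | .r5c1 => !![⟨0, 0, 1, 1⟩, ⟨0, 0, 1, 1⟩; ⟨0, 1, 1, 0⟩, ⟨0, 1, 1, 0⟩]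
  | .r5c2 => !![⟨0, 0, 1, 1⟩, ⟨0, 0, 1, 1⟩; ⟨1, 0, 0, 1⟩, ⟨1, 0, 0, 1⟩]
  | .r5c3 => !![⟨0, 0, 1, 1⟩, ⟨0, 1, 1, 0⟩; ⟨0, 1, 1, 0⟩, ⟨1, 1, 0, 0⟩]
  | .r5c4 => !![⟨0, 0, 1, 1⟩, ⟨0, 1, 1, 0⟩; ⟨1, 0, 0, 1⟩, ⟨0, 0, 1, 1⟩]
  | .r7c1 => !![⟨1, 0, 0, 0⟩, ⟨0, 1, 1, 1⟩; ⟨0, 1, 1, 1⟩, ⟨1, 0, 0, 0⟩]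
  | .r7c2 => !![⟨1, 0, 0, 0⟩, ⟨0, 1, 1, 1⟩; ⟨1, 1, 0, 1⟩, ⟨0, 0, 1, 0⟩]
  | .r7c3 => !![⟨1, 0, 0, 0⟩, ⟨1, 1, 1, 0⟩; ⟨0, 1, 1, 1⟩, ⟨0, 0, 0, 1⟩]
  | .r7c4 => !![⟨1, 0, 0, 0⟩, ⟨1, 1, 1, 0⟩; ⟨1, 1, 0, 1⟩, ⟨0, 1, 0, 0⟩]
  | .r8c1 => !![⟨1, 0, 0, 0⟩, ⟨0, 1, 1, 1⟩; ⟨1, 1, 1, 0⟩, ⟨0, 0, 0, 1⟩]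
  | .r8c2 => !![⟨1, 0, 0, 0⟩, ⟨0, 1, 1, 1⟩; ⟨1, 0, 1, 1⟩, ⟨0, 1, 0, 0⟩]
  | .r8c3 => !![⟨1, 0, 0, 0⟩, ⟨1, 1, 1, 0⟩; ⟨1, 1, 1, 0⟩, ⟨0, 0, 1, 0⟩]
  | .r8c4 => !![⟨1, 0, 0, 0⟩, ⟨1, 1, 1, 0⟩; ⟨1, 0, 1, 1⟩, ⟨1, 0, 0, 0⟩]

theorem Vertex.matrix_eq (v : Vertex) : v.matrix = v.coord.map toResidue := by
  rw [Matrix.eta_fin_two (v.coord.map toResidue)]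
  cases v <;> simp [Vertex.matrix, Vertex.coord, bits_eq]

open Vertex in
/-- All vertices. -/
def vertices : List Vertex :=
  [r1c1, r1c3, r2c1, r2c2, r2c3, r2c4, r3c1, r3c2, r3c3, r3c4, r4c1, r4c2, r4c3, r4c4,
    r5c1, r5c2, r5c3, r5c4, r7c1, r7c2, r7c3, r7c4, r8c1, r8c2, r8c3, r8c4]

theorem mem_vertices (v : Vertex) : v ∈ vertices := by
  cases v <;> simp [vertices]

/-- Distinct vertices have inequivalent matrices. -/
theorem vertices_pairwise : vertices.Pairwise fun v w =>
    ∀ g ∈ cliffordResidues, v.coord * g ≠ w.coord ∧ w.coord * g ≠ v.coord := by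
  decide +kernel

theorem exists_inv_cliffordResidues :
    ∀ a ∈ cliffordResidues, ∃ b ∈ cliffordResidues, a * b = 1 := by
  decide +kernel

/-- The vertex matrices are irreducible: as `√2 · √2 = 0` in `ℤ₂[ω]`, a matrix not annihilated by
`√2` is not a multiple of `√2`. -/
theorem sqrtTwo_smul_coord_ne_zero : ∀ v ∈ vertices, sqrtTwo • v.coord ≠ 0 := by
  decide +kernel

/-! ### Residues of the gates -/

theorem hasResidue_zero_of_forall {U : Matrix (Fin 2) (Fin 2) ℂ} {R : CoordMatrix}
    (h : ∀ i j, ∃ a b c d : ℤ, U i j = a * ω ^ 3 + b * ω ^ 2 + c * ω + d ∧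
      (⟨a, b, c, d⟩ : Coord) = R i j) : HasResidue U 0 R := by
  choose a b c d hU hR using h
  refine ⟨fun i j => ⟨a i j, b i j, c i j, d i j, by rw [pow_zero, one_mul, hU]⟩, ?_⟩
  ext i j
  rw [Matrix.map_apply, ← hR]
  exact ρ_coords (by simp [hU])

theorem hasResidue_one : HasResidue 1 0 1 := by
  refine hasResidue_zero_of_forall fun i j => ?_
  fin_cases i <;> fin_cases j
  exacts [⟨0, 0, 0, 1, by simp, by decide⟩, ⟨0, 0, 0, 0, by simp, by decide⟩,
    ⟨0, 0, 0, 0, by simp, by decide⟩, ⟨0, 0, 0, 1, by simp, by decide⟩]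

theorem hasResidue_S : HasResidue gateS.1 0 resS := by
  refine hasResidue_zero_of_forall fun i j => ?_
  fin_cases i <;> fin_cases j
  exacts [⟨0, 0, 0, 1, by simp [gateS], by decide⟩, ⟨0, 0, 0, 0, by simp [gateS], by decide⟩,
    ⟨0, 0, 0, 0, by simp [gateS], by decide⟩, ⟨0, 1, 0, 0, by simp [gateS, ω_sq], by decide⟩]

theorem hasResidue_T : HasResidue gateT.1 0 resT := by
  refine hasResidue_zero_of_forall fun i j => ?_
  fin_cases i <;> fin_cases j
  exacts [⟨0, 0, 0, 1, by simp [gateT], by decide⟩, ⟨0, 0, 0, 0, by simp [gateT], by decide⟩,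
    ⟨0, 0, 0, 0, by simp [gateT], by decide⟩, ⟨0, 0, 1, 0, by simp [gateT], by decide⟩]

theorem hasResidue_X : HasResidue gateX.1 0 resX := by
  refine hasResidue_zero_of_forall fun i j => ?_
  fin_cases i <;> fin_cases j
  exacts [⟨0, 0, 0, 0, by simp [gateX], by decide⟩, ⟨0, 0, 0, 1, by simp [gateX], by decide⟩,
    ⟨0, 0, 0, 1, by simp [gateX], by decide⟩, ⟨0, 0, 0, 0, by simp [gateX], by decide⟩]

theorem hasResidue_ω : HasResidue gateω.1 0 resω := by
  refine hasResidue_zero_of_forall fun i j => ?_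
  fin_cases i <;> fin_cases j
  exacts [⟨0, 0, 1, 0, by simp [gateω], by decide⟩, ⟨0, 0, 0, 0, by simp [gateω], by decide⟩,
    ⟨0, 0, 0, 0, by simp [gateω], by decide⟩, ⟨0, 0, 1, 0, by simp [gateω], by decide⟩]

theorem hasResidue_H : HasResidue gateH.1 1 resH := by
  have h := rt2_ne
  obtain ⟨hk, hR⟩ : HasResidue (rt2 • gateH.1) 0 resH := by
    refine hasResidue_zero_of_forall fun i j => ?_
    fin_cases i <;> fin_cases j
    exacts [⟨0, 0, 0, 1, by simp [gateH, h], by decide⟩,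
      ⟨0, 0, 0, 1, by simp [gateH, h], by decide⟩,
      ⟨0, 0, 0, 1, by simp [gateH, h], by decide⟩,
      ⟨0, 0, 0, -1, by simp [gateH, h], by decide⟩]
  have hk' : IsDenomExp gateH.1 1 := fun i j => by simpa using hk i j
  refine ⟨hk', hR ▸ ?_⟩
  ext i j
  simp [kResidue]

theorem HasResidue.pow {U : Matrix (Fin 2) (Fin 2) ℂ} {R : CoordMatrix} (h : HasResidue U 0 R)
    (n : ℕ) : HasResidue (U ^ n) 0 (R ^ n) := by
  induction n with
  | zero => simpa using hasResidue_one
  | succ n ih => simpa only [pow_succ] using ih.mul h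

theorem HasResidue.mul_H {U : Matrix (Fin 2) (Fin 2) ℂ} {k : ℕ} {R : CoordMatrix}
    (hU : HasResidue U k R) : HasResidue (gateH.1 * U) (k + 1) (resH * R) := by
  rw [add_comm]; exact hasResidue_H.mul hU

theorem gateH_mul_gateH : gateH.1 * gateH.1 = 1 := by
  have h : rt2⁻¹ * rt2⁻¹ = 1 / 2 := by rw [← mul_inv, rt2_sq, one_div]
  ext i j
  fin_cases i <;> fin_cases j <;>
    simp [gateH, Matrix.mul_apply, Fin.sum_univ_two, h]
  all_goals norm_num

theorem exists_residue_of_mem {A : U2} (hA : A ∈ 𝒮) :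
    ∃ g ∈ cliffordResidues, HasResidue A.1 0 g := by
  induction hA using Subgroup.closure_induction with
  | mem x hx =>
    rcases hx with rfl | rfl | rfl
    exacts [⟨_, by decide +kernel, hasResidue_S⟩, ⟨_, by decide +kernel, hasResidue_X⟩,
      ⟨_, by decide +kernel, hasResidue_ω⟩]
  | one => exact ⟨1, by decide +kernel, hasResidue_one⟩
  | mul x y _ _ hx hy =>
    obtain ⟨g, hg, hx⟩ := hx
    obtain ⟨g', hg', hy⟩ := hy
    exact ⟨_, mul_mem_cliffordResidues g hg g' hg', hx.mul hy⟩
  | inv x hx ih =>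
    obtain ⟨g, hg, hx'⟩ := ih
    obtain ⟨g', hg', hgg'⟩ := exists_inv_cliffordResidues g hg
    obtain ⟨r, hr⟩ := (isDenomExp_zero_of_mem (inv_mem hx)).exists_hasResidue
    have h1 : r * g = 1 := (hr.mul hx').unique (by
      rw [show (x⁻¹).1 * x.1 = 1 from congrArg Subtype.val (inv_mul_cancel x)]
      exact hasResidue_one)
    refine ⟨g', hg', ?_⟩
    rwa [← left_inv_eq_right_inv h1 hgg']

theorem exists_mem_of_residue {g : CoordMatrix} (hg : g ∈ cliffordResidues) :
    ∃ A ∈ 𝒮, HasResidue A.1 0 g := by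
  simp only [cliffordResidues, List.mem_flatMap, List.mem_map] at hg
  obtain ⟨j, -, m, -, e, -, rfl⟩ := hg
  refine ⟨gateω ^ j * gateS ^ m * gateX ^ e, ?_, ?_⟩
  · have h (x : U2) (hx : x ∈ ({gateS, gateX, gateω} : Set U2)) : x ∈ 𝒮 :=
      Subgroup.subset_closure hx
    exact mul_mem (mul_mem (pow_mem (h _ (by simp)) j) (pow_mem (h _ (by simp)) m))
      (pow_mem (h _ (by simp)) e)
  · exact ((hasResidue_ω.pow j).mul (hasResidue_S.pow m)).mul (hasResidue_X.pow e)

/-! ### Operators at a vertex -/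

/-- Up to right multiplication by an element of `𝒮`, the operator `U` has the matrix of the vertex
`v` as its `k`-residue for some `k` that fits the label of `v` and the gate counts `h` and `t`. This
`k` is the least denominator exponent of `U`, by `AtVertex.exists_isLeast`. -/
def AtVertex (U : U2) (h t : ℕ) (v : Vertex) : Prop :=
  ∃ k : ℕ, ∃ A ∈ 𝒮, HasResidue (U * A).1 k v.coord ∧ v.label h t k

variable {U : U2} {h t : ℕ} {v : Vertex}

theorem AtVertex.exists_isLeast (hU : AtVertex U h t v) :
    ∃ (k : ℕ) (hk : IsLeast {n | IsDenomExp U.1 n} k), ∃ v : Vertex,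
      SEquiv (kResidue U.1 k hk.1) v.matrix ∧
      (∀ v' : Vertex, SEquiv (kResidue U.1 k hk.1) v'.matrix → v' = v) ∧ v.label h t k := by
  obtain ⟨k, A, hA, hR, hl⟩ := hU
  have hd : IsDenomExp U.1 k := by
    have := hR.1.mul (isDenomExp_zero_of_mem (inv_mem hA))
    rwa [show (U * A).1 * (A⁻¹).1 = U.1 from congrArg Subtype.val (mul_inv_cancel_right U A)]
      at this
  refine ⟨k, ⟨hd, fun n hn => ?_⟩, v, ⟨⟨A, hA⟩, ?_⟩, ?_, hl⟩
  -- A smaller denominator exponent would make the residue matrix at `k` a multiple of `√2`.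
  · by_contra! hlt
    obtain ⟨k, rfl⟩ : ∃ l, k = l + 1 := ⟨k - 1, by omega⟩
    have hn' : IsDenomExp (U * A).1 k :=
      IsDenomExp.mono (IsDenomExp.mul hn (isDenomExp_zero_of_mem hA)) (by omega)
    obtain ⟨R, hR'⟩ := hn'.exists_hasResidue
    refine sqrtTwo_smul_coord_ne_zero v (mem_vertices v) ?_
    rw [hR.unique hR'.succ, smul_smul, show sqrtTwo * sqrtTwo = 0 by decide, zero_smul]
  · rw [Vertex.matrix_eq]
    exact (kResidue_mul hd (isDenomExp_zero_of_mem hA)).symm.trans hR.2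
  · rintro v' ⟨⟨B, hB⟩, hv'⟩
    have hB' : HasResidue (U * B).1 k v'.coord :=
      ⟨hd.mul (isDenomExp_zero_of_mem hB), by
        rw [← Vertex.matrix_eq]
        exact (kResidue_mul hd (isDenomExp_zero_of_mem hB)).trans hv'⟩
    obtain ⟨g, hg, hg'⟩ := exists_residue_of_mem (mul_mem (inv_mem hB) hA)
    have hmul : v'.coord * g = v.coord := (hB'.mul hg').unique (by
      rwa [show (U * B).1 * (B⁻¹ * A).1 = (U * A).1 from
        congrArg Subtype.val (by group : U * B * (B⁻¹ * A) = U * A)])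
    by_contra hne
    have : Std.Symm fun v w : Vertex => ∀ g ∈ cliffordResidues,
        v.coord * g ≠ w.coord ∧ w.coord * g ≠ v.coord :=
      ⟨fun v w hvw g hg => (hvw g hg).symm⟩
    exact (vertices_pairwise.forall (mem_vertices v') (mem_vertices v) hne g hg).1 hmul

/-! ### Left multiplication by `T`, `S` and `H` -/

theorem AtVertex.of_residue {U : U2} {h t k : ℕ} {v : Vertex} {A : U2} {R : CoordMatrix}
    (hA : A ∈ 𝒮) (hR : HasResidue (U * A).1 k R)
    (hg : ∃ g ∈ cliffordResidues, R * g = v.coord) (hl : v.label h t k) : AtVertex U h t v := by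
  obtain ⟨g, hg, hv⟩ := hg
  obtain ⟨B, hB, hB'⟩ := exists_mem_of_residue hg
  refine ⟨k, A * B, mul_mem hA hB, ?_, hl⟩
  rw [← mul_assoc, ← hv]
  exact hR.mul hB'

/-- The vertices of words that are empty or begin with `H` or `S`. -/
def verticesH : List Vertex :=
  [.r1c1, .r2c1, .r2c2, .r2c3, .r2c4, .r4c1, .r4c2, .r4c3, .r4c4, .r7c1, .r7c2, .r7c3, .r7c4]

/-- The vertices at which a normal form can be multiplied by `H` and the least denominator exponent
rises. -/
def verticesUp : List Vertex :=
  [.r1c1, .r1c3, .r3c1, .r3c2, .r3c3, .r3c4, .r8c1, .r8c2, .r8c3, .r8c4]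

/-- The vertices at which a normal form can be multiplied by `H` and `√2 H · R` is divisible by `√2`,
so that the least denominator exponent stays the same. -/
def verticesFlat : List Vertex := [.r5c1, .r5c2, .r5c3, .r5c4]

/-- The vertex that left multiplication by `T` leads to (a junk value outside `verticesH`). -/
def Vertex.mulT : Vertex → Vertex
  | .r1c1 => .r1c3
  | .r2c1 => .r3c1 | .r2c2 => .r3c2 | .r2c3 => .r3c3 | .r2c4 => .r3c4
  | .r4c1 => .r5c1 | .r4c2 => .r5c2 | .r4c3 => .r5c3 | .r4c4 => .r5c4
  | .r7c1 => .r8c1 | .r7c2 => .r8c2 | .r7c3 => .r8c3 | .r7c4 => .r8c4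
  | v => v

/-- The vertex that left multiplication by `S` leads to (a junk value outside `verticesH`). -/
def Vertex.mulS : Vertex → Vertex
  | .r2c1 => .r2c2 | .r2c2 => .r2c1 | .r2c3 => .r2c4 | .r2c4 => .r2c3
  | .r4c1 => .r4c2 | .r4c2 => .r4c1 | .r4c3 => .r4c4 | .r4c4 => .r4c3
  | .r7c1 => .r7c2 | .r7c2 => .r7c1 | .r7c3 => .r7c4 | .r7c4 => .r7c3
  | v => v

/-- The vertex that left multiplication by `H` leads to (a junk value outside `verticesUp` and
`verticesFlat`). -/
def Vertex.mulH : Vertex → Vertex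
  | .r1c1 => .r2c1 | .r1c3 => .r2c3
  | .r3c1 | .r3c2 | .r8c1 | .r8c2 => .r4c1
  | .r3c3 | .r3c4 | .r8c3 | .r8c4 => .r4c3
  | .r5c1 | .r5c2 => .r7c1
  | .r5c3 | .r5c4 => .r7c3
  | v => v

theorem resT_mul_coord :
    ∀ v ∈ verticesH, ∃ g ∈ cliffordResidues, resT * v.coord * g = v.mulT.coord := by
  decide +kernel

theorem resS_mul_coord :
    ∀ v ∈ verticesH, ∃ g ∈ cliffordResidues, resS * v.coord * g = v.mulS.coord := by
  decide +kernel

theorem resH_mul_coord :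
    ∀ v ∈ verticesUp, ∃ g ∈ cliffordResidues, resH * v.coord * g = v.mulH.coord := by
  decide +kernel

-- Declared only here: with this instance in scope, `decide` would run a quantifier over the members
-- of `cliffordResidues` through all `16 ^ 4` residue matrices in the statements above that begin
-- with one.
instance : Fintype Coord :=
  Fintype.ofSurjective
    (fun x : ZMod 2 × ZMod 2 × ZMod 2 × ZMod 2 => (⟨x.1, x.2.1, x.2.2.1, x.2.2.2⟩ : Coord))
    fun x => ⟨(x.p, x.q, x.r, x.s), rfl⟩

theorem sqrtTwo_dvd_resH_mul_coord :
    ∀ v ∈ verticesFlat, ∀ i j, ∃ x, sqrtTwo * x = (resH * v.coord) i j := by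
  decide +kernel

/-- The equation `√2 X = √2 H · R`, with `R` the matrix of a vertex in `verticesFlat`, has several
solutions `X` modulo `2`. Their second row is determined by the first, and those with the weight of
the first row divisible by `4` belong to a single vertex. -/
theorem reduced_resH_mul_coord : ∀ v ∈ verticesFlat, ∀ x y : Coord,
    sqrtTwo * x = v.coord 0 0 + v.coord 1 0 → sqrtTwo * y = v.coord 0 1 + v.coord 1 1 →
    4 ∣ x.weight + y.weight → ∃ g ∈ cliffordResidues,
      !![x, y; sqrtTwo * v.coord 1 0 - x, sqrtTwo * v.coord 1 1 - y] * g = v.mulH.coord := by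
  decide +kernel

section Label

variable {h t k : ℕ} {v : Vertex}

theorem label_mulT (hv : v ∈ verticesH) (hl : v.label h t k) :
    (v.mulT ∈ verticesUp ∨ v.mulT ∈ verticesFlat) ∧ v.mulT.label h (t + 1 : ℕ) k := by
  cases v <;> simp [verticesH, verticesUp, verticesFlat, Vertex.mulT, Vertex.label] at * <;> omega

theorem label_mulS (hv : v ∈ verticesH) (hl : v.label h t k) :
    v.mulS ∈ verticesH ∧ v.mulS.label h t k := by
  cases v <;> simp [verticesH, Vertex.mulS, Vertex.label] at * <;> omega

theorem label_mulH_up (hv : v ∈ verticesUp) (hl : v.label h t k) :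
    v.mulH ∈ verticesH ∧ v.mulH.label (h + 1 : ℕ) t (k + 1 : ℕ) := by
  cases v <;> simp [verticesH, verticesUp, Vertex.mulH, Vertex.label] at * <;> omega

theorem label_mulH_flat (hv : v ∈ verticesFlat) (hl : v.label h t k) :
    v.mulH ∈ verticesH ∧ v.mulH.label (h + 1 : ℕ) t k ∧ 2 ≤ k := by
  cases v <;> simp [verticesH, verticesFlat, Vertex.mulH, Vertex.label] at * <;> omega

end Label

namespace AtVertex

variable {U : U2} {h t : ℕ} {v : Vertex}

theorem mul_T (hU : AtVertex U h t v) (hv : v ∈ verticesH) :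
    ∃ w, (w ∈ verticesUp ∨ w ∈ verticesFlat) ∧ AtVertex (gateT * U) h (t + 1) w := by
  obtain ⟨k, A, hA, hR, hl⟩ := hU
  obtain ⟨hw, hl⟩ := label_mulT hv hl
  refine ⟨_, hw, .of_residue hA ?_ (resT_mul_coord v hv) hl⟩
  rw [mul_assoc]
  exact Nat.zero_add k ▸ hasResidue_T.mul hR

theorem mul_S (hU : AtVertex U h t v) (hv : v ∈ verticesH) :
    ∃ w ∈ verticesH, AtVertex (gateS * U) h t w := by
  obtain ⟨k, A, hA, hR, hl⟩ := hU
  obtain ⟨hw, hl⟩ := label_mulS hv hl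
  refine ⟨_, hw, .of_residue hA ?_ (resS_mul_coord v hv) hl⟩
  rw [mul_assoc]
  exact Nat.zero_add k ▸ hasResidue_S.mul hR

theorem mul_H_of_up (hU : AtVertex U h t v) (hv : v ∈ verticesUp) :
    ∃ w ∈ verticesH, AtVertex (gateH * U) (h + 1) t w := by
  obtain ⟨k, A, hA, hR, hl⟩ := hU
  obtain ⟨hw, hl⟩ := label_mulH_up hv hl
  refine ⟨_, hw, .of_residue hA ?_ (resH_mul_coord v hv) hl⟩
  rw [mul_assoc]
  exact hR.mul_H

theorem mul_H_of_flat (hU : AtVertex U h t v) (hv : v ∈ verticesFlat) :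
    ∃ w ∈ verticesH, AtVertex (gateH * U) (h + 1) t w := by
  obtain ⟨k, A, hA, hR, hl⟩ := hU
  obtain ⟨hw, hl, hk⟩ := label_mulH_flat hv hl
  have hHR : HasResidue (gateH * (U * A)).1 (k + 1) (resH * v.coord) := hR.mul_H
  obtain ⟨X, hX⟩ : ∃ X, HasResidue (gateH * (U * A)).1 k X := by
    choose Y hY using sqrtTwo_dvd_resH_mul_coord v hv
    refine IsDenomExp.exists_hasResidue (HasResidue.isDenomExp_of_smul (R := Matrix.of Y) ?_)
    convert hHR using 1
    ext1 i j
    exact hY i j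
  -- Both `√2 X = √2 H · R` and, as `H` is an involution, `√2 R = √2 H · X`.
  have h1 : sqrtTwo • X = resH * v.coord := hX.succ.unique hHR
  have h2 : sqrtTwo • v.coord = resH * X := hR.succ.unique (by
    have := hX.mul_H
    rwa [show gateH.1 * (gateH * (U * A)).1 = (U * A).1 by
      rw [show (gateH * (U * A)).1 = gateH.1 * (U * A).1 from rfl, ← mul_assoc, gateH_mul_gateH,
        one_mul]] at this)
  have e1 (j : Fin 2) : sqrtTwo * X 0 j = v.coord 0 j + v.coord 1 j := by
    simpa [resH, Matrix.mul_apply, Fin.sum_univ_two] using congrFun (congrFun h1 0) j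
  have e2 (j : Fin 2) : X 1 j = sqrtTwo * v.coord 1 j - X 0 j := by
    have : sqrtTwo * v.coord 1 j = X 0 j + X 1 j := by
      simpa [resH, Matrix.mul_apply, Fin.sum_univ_two] using congrFun (congrFun h2 1) j
    rw [this, add_sub_cancel_left]
  refine ⟨_, hw, .of_residue hA (R := X) (by rwa [mul_assoc]) ?_ hl⟩
  rw [Matrix.eta_fin_two X, e2, e2]
  exact reduced_resH_mul_coord v hv _ _ (e1 0) (e1 1) (hX.four_dvd_weight hk 0)

theorem one : AtVertex 1 0 0 .r1c1 :=
  ⟨0, 1, one_mem _, by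
    rw [mul_one, show Vertex.r1c1.coord = 1 by decide +kernel]
    exact hasResidue_one, by simp [Vertex.label]⟩

theorem mul_mem (hU : AtVertex U h t v) {A : U2} (hA : A ∈ 𝒮) : AtVertex (U * A) h t v := by
  obtain ⟨k, B, hB, hR, hl⟩ := hU
  exact ⟨k, A⁻¹ * B, Subgroup.mul_mem _ (inv_mem hA) hB,
    by rwa [mul_assoc, mul_inv_cancel_left], hl⟩

end AtVertex

/-! ### Words -/

/-- The operator of the word `w` is at a vertex of the list `l`, for the gate counts of `w`. -/
def WordAt (l : List Vertex) (w : List Gate) : Prop :=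
  ∃ v ∈ l, AtVertex (w.map Gate.op).prod (w.count .H) (w.count .T) v

theorem wordAt_nil : WordAt verticesH [] := ⟨.r1c1, by simp [verticesH], AtVertex.one⟩

namespace WordAt

variable {w : List Gate}

theorem cons_S (hw : WordAt verticesH w) : WordAt verticesH (.S :: w) := by
  obtain ⟨v, hv, hw⟩ := hw
  simpa [WordAt, Gate.op] using hw.mul_S hv

theorem cons_T (hw : WordAt verticesH w) :
    WordAt verticesUp (.T :: w) ∨ WordAt verticesFlat (.T :: w) := by
  obtain ⟨v, hv, hw⟩ := hw
  obtain ⟨w, h | h, hw⟩ := hw.mul_T hv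
  · exact .inl ⟨w, h, by simpa [Gate.op] using hw⟩
  · exact .inr ⟨w, h, by simpa [Gate.op] using hw⟩

theorem cons_H (hw : WordAt verticesUp w ∨ WordAt verticesFlat w) :
    WordAt verticesH (.H :: w) := by
  rcases hw with ⟨v, hv, hw⟩ | ⟨v, hv, hw⟩
  · simpa [WordAt, Gate.op] using hw.mul_H_of_up hv
  · simpa [WordAt, Gate.op] using hw.mul_H_of_flat hv

end WordAt

theorem exists_eq_append_of_mem {w : List Gate} (hw : w ∈ normalFormExpr.matches') :
    ∃ (p : List Gate) (L : List (List Gate)) (s : List Gate), w = p ++ L.flatten ++ s ∧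
      (p = [.T] ∨ p = []) ∧ (∀ y ∈ L, y = [.H, .T] ∨ y = [.S, .H, .T]) ∧
      (s = [] ∨ s = [.H] ∨ s = [.S, .H]) := by
  simp only [normalFormExpr, RegularExpression.matches'_mul, RegularExpression.matches'_add,
    RegularExpression.matches'_star, RegularExpression.matches'_char,
    RegularExpression.matches'_epsilon, Language.mem_mul, Language.mem_kstar] at hw
  obtain ⟨_, ⟨p, hp, _, ⟨L, rfl, hL⟩, rfl⟩, s, hs, rfl⟩ := hw
  refine ⟨p, L, s, rfl, hp, fun y hy => ?_, ?_⟩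
  · rcases hL y hy with h | h
    · obtain ⟨_, rfl, _, rfl, rfl⟩ := h
      exact .inl rfl
    · obtain ⟨_, ⟨_, rfl, _, rfl, rfl⟩, _, rfl, rfl⟩ := h
      exact .inr rfl
  · rcases hs with (h | h) | h
    · exact .inl h
    · exact .inr (.inl h)
    · obtain ⟨_, rfl, _, rfl, rfl⟩ := h
      exact .inr (.inr rfl)

theorem NormalForm.exists_atVertex (M : NormalForm) :
    ∃ v, AtVertex M.op M.hCount M.tCount v := by
  obtain ⟨p, L, s, hw, hp, hL, hs⟩ := exists_eq_append_of_mem M.word_mem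
  have hs' : WordAt verticesH s := by
    have hH : WordAt verticesH [.H] :=
      .cons_H (.inl ⟨.r1c1, by simp [verticesUp], AtVertex.one⟩)
    rcases hs with rfl | rfl | rfl
    exacts [wordAt_nil, hH, hH.cons_S]
  have hLs : WordAt verticesH (L.flatten ++ s) := by
    clear hw
    induction L with
    | nil => exact hs'
    | cons y L ih =>
      have hHT := WordAt.cons_H (ih fun y hy => hL y (List.mem_cons_of_mem _ hy)).cons_T
      rcases hL y List.mem_cons_self with rfl | rfl
      exacts [hHT, hHT.cons_S]
  obtain ⟨v, hv⟩ : ∃ v, AtVertex (M.word.map Gate.op).prod M.hCount M.tCount v := by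
    rw [NormalForm.hCount, NormalForm.tCount, hw, List.append_assoc]
    rcases hp with rfl | rfl
    · rcases hLs.cons_T with ⟨v, -, h⟩ | ⟨v, -, h⟩ <;> exact ⟨v, h⟩
    · obtain ⟨v, -, h⟩ := hLs
      exact ⟨v, h⟩
  exact ⟨v, hv.mul_mem M.last.2⟩

end MatsumotoAmano

theorem mainTheorem7 (M : MatsumotoAmano.NormalForm) :
    ∃ (k : ℕ) (hk : IsLeast {n | MatsumotoAmano.IsDenomExp M.op.1 n} k),
      ∃ v : MatsumotoAmano.Vertex,
        MatsumotoAmano.SEquiv (MatsumotoAmano.kResidue M.op.1 k hk.1) v.matrix ∧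
        (∀ v' : MatsumotoAmano.Vertex,
          MatsumotoAmano.SEquiv (MatsumotoAmano.kResidue M.op.1 k hk.1) v'.matrix → v' = v) ∧
        v.label M.hCount M.tCount k := by
  obtain ⟨v, hv⟩ := M.exists_atVertex
  exact hv.exists_isLeast
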